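/- Let $K$ be a valuation field of height $1$, i.e. a field together with a valuation ring $\mathcal O_K$ with fraction field $K$ that has exactly one nonzero prime ideal, its maximal ideal $\mathfrak m_K$. Let $M$ be a torsion-free $\mathcal O_K$-module whose rank $\operatorname{rank}_{\mathcal O_K}(M)=\dim_K(K\otimes_{\mathcal O_K}M)$ is finite, and let $\pi\in\mathfrak m_K$ be any nonzero element. Put $\mathcal O_{\widehat K}=\varprojlim_n \mathcal O_K/\pi^n\mathcal O_K$ and $\widehat M=\varprojlim_n M/\pi^nM$. An $\mathcal O_K$-module $N$ is called *almost finitely generated* if for every $\varpi\in\widetilde{\mathfrak m}_K$ there is a finitely generated submodule of $N$ containing $\varpi N$, where $\widetilde{\mathfrak m}_K=\mathcal O_K$ if the valuation is discrete and $\widetilde{\mathfrak m}_K=\mathfrak m_K$ otherwise. It is called *separated* if $\bigcap_{\varpi\in\mathfrak m_K\setminus 0}\varpi N=0$, and *complete* if the canonical map $N\to\widehat N$ is an isomorphism. A torsion-free $N$ is called *bounded* if it is isomorphic to a submodule of a free module $\mathcal O_K^{\oplus I}$ for some set $I$. The field $K$ is *complete* if $\mathcal O_K$ is complete. 1. The ring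 $\mathcal O_{\widehat K}$ is a valuation ring of height $1$. Over it, $\widehat M$ is almost finitely generated and torsion-free, with $\operatorname{rank}_{\mathcal O_{\widehat K}}(\widehat M)\le\operatorname{rank}_{\mathcal O_K}(M)$. Moreover, the canonical morphism $M\otimes_{\mathcal O_K}\mathcal O_{\widehat K}\to\widehat M$ is surjective. 2. If $K$ is complete, then the following four properties of $M$ are equivalent: bounded, separated, complete, almost finitely generated. -/

import Mathlib

open scoped TensorProduct

universe u v

/-- The height of a valuation field with valuation ring `O`: the number of nonzero prime ideals
of `O`. -/
noncomputable def valuationHeight (O : Type u) [CommRing O] : ℕ∞ :=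
  {p : Ideal O | p.IsPrime ∧ p ≠ ⊥}.encard

/-- The rank of an `O`-module `M`: the dimension over the fraction field `K` of `O` of
`K ⊗[O] M`. -/
noncomputable def valuationRank (O : Type u) (K : Type u) (M : Type v) [CommRing O] [CommRing K]
    [Algebra O K] [AddCommGroup M] [Module O M] : Cardinal.{max u v} :=
  Module.rank K (K ⊗[O] M)

open scoped Classical in
/-- The ideal that defines the basic setup of almost ring theory over a valuation ring `O` of
height one: the whole ring if the valuation is discrete, the maximal ideal otherwise. -/
noncomputable def almostIdeal (O : Type u) [CommRing O] [IsDomain O] [IsLocalRing O] : Ideal O :=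
  if IsDiscreteValuationRing O then ⊤ else IsLocalRing.maximalIdeal O

/-- An `O`-module `M` is almost finitely generated if for every `ϖ` in the almost ideal of `O`
there is a finitely generated submodule of `M` that contains `ϖ M`. -/
def IsAlmostFinitelyGenerated (O : Type u) (M : Type v) [CommRing O] [IsDomain O] [IsLocalRing O]
    [AddCommGroup M] [Module O M] : Prop :=
  ∀ ϖ ∈ almostIdeal O, ∃ N : Submodule O M, N.FG ∧ ∀ x : M, ϖ • x ∈ N

/-- The divisible submodule of `M`: the intersection of the submodules `ϖ M`, where `ϖ` runs
through the nonzero elements of the maximal ideal of `O`. -/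
def divisibleSubmodule (O : Type u) (M : Type v) [CommRing O] [IsLocalRing O]
    [AddCommGroup M] [Module O M] : Submodule O M :=
  ⨅ ϖ : {ϖ : O // ϖ ∈ IsLocalRing.maximalIdeal O ∧ ϖ ≠ 0},
    LinearMap.range (LinearMap.lsmul O M ϖ.1)

/-- `M` is separated if its divisible submodule vanishes. -/
def IsSeparatedModule (O : Type u) (M : Type v) [CommRing O] [IsLocalRing O]
    [AddCommGroup M] [Module O M] : Prop :=
  divisibleSubmodule O M = ⊥

/-- A torsion-free `O`-module `M` is bounded if it is isomorphic to a submodule of the free module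
`O^(⊕ I)` for some set `I`. (Index sets in the universe of `M` suffice: if `M` is nonzero, at most
`#M` coordinates are not identically zero on `M`, and the others may be dropped.) -/
def IsBoundedModule (O : Type u) (M : Type v) [CommRing O] [AddCommGroup M] [Module O M] : Prop :=
  ∃ (I : Type v) (f : M →ₗ[O] (I →₀ O)), Function.Injective f

/-!
Everything rests on one statement: over a valuation ring `O` of height one that is `p`-adically
complete, a separated torsion-free module `M` of finite rank is almost finitely generated
(`isAlmostFinitelyGenerated_of_isHausdorff`). This is the integral form of the fact that a
finite-dimensional Hausdorff topological vector space over a complete valued field carries the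
product topology. No norm is used: height one only enters through the fact that every nonzero
element of `O` divides a power of any nonzero nonunit (`dvd_pow_of_valuationHeight_eq_one`).

The proof is an induction on the rank. In rank one, an element `v` outside `ϖ M` spans a submodule
that contains `ϖ M`, as divisibility in `O` is total, and such a `v` exists when `M` is nonzero and
separated. In general, let `N` be the saturation of a nonzero vector. It is almost finitely
generated. Hence, up to isomorphism, it lies between a finite free module and a nonzero multiple of
it, and is therefore complete. This makes `M / N` separated (`isHausdorff_quotient`), and almost
finite generation is stable under extensions, because `ϖ` is a product of two elements of the almost
ideal.

The same sandwich between finite free modules shows that almost finitely generated modules are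
bounded and complete, which gives the equivalence of the four properties (`tfae_of_isAdicComplete`).

For the completion `A` of `O`, density of `O` shows that every nonzero element of `A` is an element
of `O` times a unit, so that `A` inherits being a valuation ring of height one. The `A`-span of `M`
in its completion is a separated module of finite rank over the complete ring `A`. By the first
statement it is complete, and being dense it is everything (`span_range_eq_top_of_dense`).
-/

/-! ### Divisibility in a valuation ring of height one -/

section Height

variable {O : Type u} [CommRing O] [IsDomain O] [ValuationRing O]

/-- The radical of a nonzero principal ideal is an intersection of nonzero primes, and in height one
the maximal ideal is the only one. -/
theorem dvd_pow_of_valuationHeight_eq_one (hO : valuationHeight O = 1) {p c : O}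
    (hp : p ∈ IsLocalRing.maximalIdeal O) (hc : c ≠ 0) : ∃ n : ℕ, c ∣ p ^ n := by
  by_cases hp0 : p = 0
  · exact ⟨1, by simp [hp0]⟩
  obtain ⟨P, hP⟩ := Set.encard_eq_one.1 hO
  have key : ∀ J : Ideal O, J.IsPrime → J ≠ ⊥ → J = IsLocalRing.maximalIdeal O := by
    intro J hJ hJ0
    have h1 : J ∈ ({P} : Set (Ideal O)) := hP ▸ ⟨hJ, hJ0⟩
    have h2 : IsLocalRing.maximalIdeal O ∈ ({P} : Set (Ideal O)) :=
      hP ▸ ⟨inferInstance, fun h => hp0 (by simpa [h] using hp)⟩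
    rw [Set.mem_singleton_iff] at h1 h2
    rw [h1, h2]
  have hrad : p ∈ (Ideal.span {c}).radical := by
    rw [Ideal.radical_eq_sInf, Ideal.mem_sInf]
    rintro J ⟨hcJ, hJ⟩
    have hJ0 : J ≠ ⊥ := by
      rintro rfl
      exact hc (by simpa using hcJ (Ideal.mem_span_singleton_self c))
    rw [key J hJ hJ0]
    exact hp
  obtain ⟨n, hn⟩ := hrad
  exact ⟨n, Ideal.mem_span_singleton.1 hn⟩

/-- The almost ideal is idempotent, in the strong form that each of its elements is a product of two
of them: an element of the maximal ideal that is not such a product would be a uniformizer, and the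
ring a discrete valuation ring. -/
theorem exists_mul_eq_of_mem_almostIdeal (hO : valuationHeight O = 1) {ϖ : O}
    (hϖ : ϖ ∈ almostIdeal O) : ∃ α ∈ almostIdeal O, ∃ β ∈ almostIdeal O, α * β = ϖ := by
  by_cases hD : IsDiscreteValuationRing O
  · rw [almostIdeal, if_pos hD]
    exact ⟨ϖ, trivial, 1, trivial, mul_one ϖ⟩
  rw [almostIdeal, if_neg hD] at hϖ ⊢
  by_contra! hcon
  have hϖ0 : ϖ ≠ 0 := by
    rintro rfl
    exact hcon 0 (zero_mem _) 0 (zero_mem _) (mul_zero 0)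
  have hirr : Irreducible ϖ := by
    refine ⟨fun h => (IsLocalRing.mem_maximalIdeal ϖ).1 hϖ h, fun a b hab => ?_⟩
    by_contra! h
    exact hcon a ((IsLocalRing.mem_maximalIdeal a).2 h.1) b
      ((IsLocalRing.mem_maximalIdeal b).2 h.2) hab.symm
  refine hD (IsDiscreteValuationRing.ofHasUnitMulPowIrreducibleFactorization
    ⟨ϖ, hirr, fun {x} hx => ?_⟩)
  obtain ⟨n, hn⟩ := dvd_pow_of_valuationHeight_eq_one hO hϖ hx
  obtain ⟨i, -, hi⟩ := (dvd_prime_pow hirr.prime n).1 hn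
  exact ⟨i, hi.symm⟩

theorem maximalIdeal_le_almostIdeal : IsLocalRing.maximalIdeal O ≤ almostIdeal O := by
  unfold almostIdeal
  split_ifs
  · exact le_top
  · exact le_rfl

end Height

/-! ### Adic convergence for a principal ideal -/

section Principal

variable {A : Type u} [CommRing A] {M : Type v} [AddCommGroup M] [Module A M] {p : A}

theorem mem_span_singleton_pow_smul_top {n : ℕ} {x : M} :
    x ∈ (Ideal.span {p} ^ n • ⊤ : Submodule A M) ↔ ∃ y : M, p ^ n • y = x := by
  rw [Ideal.span_singleton_pow, Submodule.ideal_span_singleton_smul,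
    Submodule.mem_smul_pointwise_iff_exists]
  simp

theorem isHausdorff_span_singleton_iff :
    IsHausdorff (Ideal.span {p}) M ↔ ∀ x : M, (∀ n : ℕ, ∃ y : M, p ^ n • y = x) → x = 0 := by
  simp only [isHausdorff_iff, SModEq.zero, mem_span_singleton_pow_smul_top]

theorem exists_pow_smul_eq_sub_of_le {f : ℕ → M}
    (hf : ∀ n, ∃ y : M, p ^ n • y = f (n + 1) - f n) {m n : ℕ} (hmn : m ≤ n) :
    ∃ y : M, p ^ m • y = f n - f m := by
  induction n, hmn using Nat.le_induction with
  | base => exact ⟨0, by simp⟩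
  | succ n hmn ih =>
    obtain ⟨y, hy⟩ := ih
    obtain ⟨z, hz⟩ := hf n
    refine ⟨p ^ (n - m) • z + y, ?_⟩
    rw [smul_add, smul_smul, ← pow_add, Nat.add_sub_cancel' hmn, hz, hy]
    abel

theorem isPrecomplete_span_singleton_iff :
    IsPrecomplete (Ideal.span {p}) M ↔
      ∀ f : ℕ → M, (∀ n, ∃ y : M, p ^ n • y = f (n + 1) - f n) →
        ∃ L : M, ∀ n, ∃ y : M, p ^ n • y = L - f n := by
  rw [isPrecomplete_iff]
  simp only [SModEq.sub_mem, mem_span_singleton_pow_smul_top]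
  constructor
  · intro h f hf
    obtain ⟨L, hL⟩ := h f fun {m n} hmn => by
      obtain ⟨y, hy⟩ := exists_pow_smul_eq_sub_of_le hf hmn
      exact ⟨-y, by rw [smul_neg, hy, neg_sub]⟩
    refine ⟨L, fun n => ?_⟩
    obtain ⟨y, hy⟩ := hL n
    exact ⟨-y, by rw [smul_neg, hy, neg_sub]⟩
  · intro h f hf
    obtain ⟨L, hL⟩ := h f fun n => by
      obtain ⟨y, hy⟩ := hf (Nat.le_succ n)
      exact ⟨-y, by rw [smul_neg, hy, neg_sub]⟩
    refine ⟨L, fun n => ?_⟩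
    obtain ⟨y, hy⟩ := hL n
    exact ⟨-y, by rw [smul_neg, hy, neg_sub]⟩

/-- A complete submodule `N` that is saturated with respect to `p` is closed: if `x` is congruent to
an element of `N` modulo every `p ^ n M`, these elements form a Cauchy sequence of `N`, by
saturation, and `x` is its limit. -/
theorem isHausdorff_quotient [IsHausdorff (Ideal.span {p}) M] (N : Submodule A M)
    [IsPrecomplete (Ideal.span {p}) N] (hN : ∀ (n : ℕ) (x : M), p ^ n • x ∈ N → x ∈ N) :
    IsHausdorff (Ideal.span {p}) (M ⧸ N) := by
  rw [isHausdorff_span_singleton_iff]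
  intro x
  obtain ⟨x, rfl⟩ := N.mkQ_surjective x
  intro hx
  have hdec : ∀ n, ∃ y : M, ∃ z : N, x = p ^ n • y + z := by
    intro n
    obtain ⟨y, hy⟩ := hx n
    obtain ⟨y, rfl⟩ := N.mkQ_surjective y
    rw [← map_smul, ← sub_eq_zero, ← map_sub, Submodule.mkQ_apply,
      Submodule.Quotient.mk_eq_zero] at hy
    exact ⟨y, ⟨_, neg_mem hy⟩, by simp⟩
  choose y z hyz using hdec
  have hz : ∀ n, ∃ w : N, p ^ n • w = z (n + 1) - z n := by
    intro n
    have h : p ^ n • (y n - p • y (n + 1)) = ((z (n + 1) - z n : N) : M) := by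
      have h1 := hyz n
      rw [hyz (n + 1), pow_succ, mul_smul] at h1
      rw [smul_sub, AddSubgroupClass.coe_sub, sub_eq_sub_iff_add_eq_add, ← h1, add_comm]
    exact ⟨⟨_, hN n _ (h ▸ (z (n + 1) - z n).2)⟩, Subtype.ext h⟩
  obtain ⟨L, hL⟩ := isPrecomplete_span_singleton_iff (p := p).1 inferInstance z hz
  have hxL : x - L = 0 := by
    refine isHausdorff_span_singleton_iff.1 ‹IsHausdorff (Ideal.span {p}) M› (x - L) fun n => ?_
    obtain ⟨w, hw⟩ := hL n
    refine ⟨y n - w, ?_⟩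
    have hw' : p ^ n • (w : M) = L - z n := congrArg Subtype.val hw
    rw [smul_sub, hw', hyz n]
    abel
  rw [Submodule.mkQ_apply, Submodule.Quotient.mk_eq_zero, sub_eq_zero.1 hxL]
  exact L.2

/-- A complete submodule that is dense in a separated module is everything. -/
theorem eq_top_of_isPrecomplete_of_dense [IsHausdorff (Ideal.span {p}) M] (N : Submodule A M)
    [IsPrecomplete (Ideal.span {p}) N] (hN : ∀ x : M, ∃ z ∈ N, ∃ y : M, x = z + p • y) :
    N = ⊤ := by
  refine eq_top_iff.2 fun x _ => ?_
  choose z hz y hy using hN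
  -- the remainders of the successive approximation of `x`, and the partial sums
  let r : ℕ → M := fun n => y^[n] x
  let s : ℕ → N := fun n => ∑ i ∈ Finset.range n, p ^ i • ⟨z (r i), hz (r i)⟩
  have hs : ∀ n, x = s n + p ^ n • r n := by
    intro n
    induction n with
    | zero => simp [s, r]
    | succ n ih =>
      have h1 : r (n + 1) = y (r n) := Function.iterate_succ_apply' y n x
      have h2 : (s (n + 1) : M) = s n + p ^ n • z (r n) := by
        simp [s, Finset.sum_range_succ]
      rw [h1, h2, pow_succ, mul_smul, add_assoc, ← smul_add, ← hy (r n), ← ih]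
  obtain ⟨L, hL⟩ := isPrecomplete_span_singleton_iff (p := p).1 inferInstance s fun n =>
    ⟨⟨z (r n), hz (r n)⟩, by simp [s, Finset.sum_range_succ]⟩
  have hxL : x - L = 0 := by
    refine isHausdorff_span_singleton_iff.1 ‹IsHausdorff (Ideal.span {p}) M› (x - L) fun n => ?_
    obtain ⟨w, hw⟩ := hL n
    refine ⟨r n - w, ?_⟩
    have hw' : p ^ n • (w : M) = L - s n := congrArg Subtype.val hw
    have := hs n
    rw [smul_sub, hw', ← sub_eq_of_eq_add' this]
    abel
  rw [sub_eq_zero.1 hxL]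
  exact L.2

end Principal

/-! ### Ranks and saturation -/

section Saturation

variable {A : Type u} [CommRing A] [IsDomain A] {M : Type v} [AddCommGroup M] [Module A M]

/-- The saturation of a submodule `S`: the elements that have a nonzero multiple in `S`. -/
def Submodule.saturation (S : Submodule A M) : Submodule A M where
  carrier := {x | ∃ a : A, a ≠ 0 ∧ a • x ∈ S}
  zero_mem' := ⟨1, one_ne_zero, by simp⟩
  add_mem' := by
    rintro x y ⟨a, ha, hx⟩ ⟨b, hb, hy⟩
    refine ⟨a * b, mul_ne_zero ha hb, ?_⟩
    rw [smul_add]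
    refine add_mem ?_ ?_
    · rw [mul_comm, mul_smul]
      exact S.smul_mem b hx
    · rw [mul_smul]
      exact S.smul_mem a hy
  smul_mem' := by
    rintro c x ⟨a, ha, hx⟩
    exact ⟨a, ha, by rw [smul_comm]; exact S.smul_mem c hx⟩

theorem Submodule.le_saturation (S : Submodule A M) : S ≤ S.saturation := fun x hx =>
  ⟨1, one_ne_zero, by rwa [one_smul]⟩

theorem Submodule.mem_saturation_of_smul_mem {S : Submodule A M} {a : A} (ha : a ≠ 0) {x : M}
    (hx : a • x ∈ S.saturation) : x ∈ S.saturation := by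
  obtain ⟨b, hb, h⟩ := hx
  exact ⟨b * a, mul_ne_zero hb ha, by rwa [mul_smul]⟩

theorem Submodule.isTorsionFree_quotient_saturation (S : Submodule A M) :
    Module.IsTorsionFree A (M ⧸ S.saturation) := by
  refine Module.IsTorsionFree.of_smul_eq_zero fun a x hx => ?_
  obtain ⟨x, rfl⟩ := S.saturation.mkQ_surjective x
  refine or_iff_not_imp_left.2 fun ha => ?_
  rw [← map_smul, Submodule.mkQ_apply, Submodule.Quotient.mk_eq_zero] at hx
  rw [Submodule.mkQ_apply, Submodule.Quotient.mk_eq_zero]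
  exact Submodule.mem_saturation_of_smul_mem ha hx

theorem Submodule.rank_quotient_eq_zero_iff {S : Submodule A M} :
    Module.rank A (M ⧸ S) = 0 ↔ S.saturation = ⊤ := by
  rw [rank_eq_zero_iff, eq_top_iff]
  constructor
  · intro h x _
    obtain ⟨a, ha, hx⟩ := h (S.mkQ x)
    rw [← map_smul, Submodule.mkQ_apply, Submodule.Quotient.mk_eq_zero] at hx
    exact ⟨a, ha, hx⟩
  · intro h x
    obtain ⟨x, rfl⟩ := S.mkQ_surjective x
    obtain ⟨a, ha, hx⟩ := h (x := x) trivial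
    exact ⟨a, ha, by rwa [← map_smul, Submodule.mkQ_apply, Submodule.Quotient.mk_eq_zero]⟩

/-- Extension of scalars does not increase a finite rank: a maximal linearly independent family of
`M` spans a submodule of `P` with torsion quotient. -/
theorem rank_le_rank_of_span_eq_top {B : Type u} [CommRing B] [IsDomain B] [Algebra A B]
    (hinj : Function.Injective (algebraMap A B)) {P : Type v} [AddCommGroup P] [Module A P]
    [Module B P] [IsScalarTower A B P] (f : M →ₗ[A] P)
    (hf : Submodule.span B (Set.range f) = ⊤) (hM : Module.rank A M < Cardinal.aleph0) :
    Module.rank B P ≤ Module.rank A M := by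
  obtain ⟨s, hs, hli⟩ := exists_set_linearIndependent A M
  have hsat : (Submodule.span A s).saturation = ⊤ := by
    rw [← Submodule.rank_quotient_eq_zero_iff]
    have h := rank_quotient_add_rank_of_isDomain (Submodule.span A s)
    rw [rank_span_set (s := s) hli, hs] at h
    exact Cardinal.eq_of_add_eq_add_right (h.trans (zero_add _).symm) hM
  have hsat' : (Submodule.span B (f '' s)).saturation = ⊤ := by
    rw [eq_top_iff, ← hf, Submodule.span_le]
    rintro _ ⟨x, rfl⟩
    obtain ⟨a, ha, hx⟩ := hsat.ge (x := x) trivial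
    refine ⟨algebraMap A B a, (map_ne_zero_iff _ hinj).2 ha, ?_⟩
    rw [algebraMap_smul, ← map_smul]
    have h2 : f (a • x) ∈ (Submodule.span A s).map f := Submodule.mem_map_of_mem hx
    rw [Submodule.map_span] at h2
    exact Submodule.span_le_restrictScalars A B _ h2
  have h := rank_quotient_add_rank_of_isDomain (Submodule.span B (f '' s))
  rw [Submodule.rank_quotient_eq_zero_iff.2 hsat', zero_add] at h
  rw [← h, ← hs]
  exact (rank_span_le _).trans Cardinal.mk_image_le

end Saturation

theorem valuationRank_eq_lift_rank {A : Type u} [CommRing A] {M : Type v} [AddCommGroup M]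
    [Module A M] (K : Type u) [Field K] [Algebra A K] [IsFractionRing A K] :
    valuationRank A K M = Cardinal.lift.{u} (Module.rank A M) := by
  have h1 : Module.rank K (K ⊗[A] M) = Module.rank A (K ⊗[A] M) :=
    IsLocalization.rank_eq K (nonZeroDivisors A) le_rfl
  have h2 := IsLocalizedModule.lift_rank_eq (nonZeroDivisors A) (TensorProduct.mk A K M 1) le_rfl
  rw [valuationRank, h1, ← Cardinal.lift_id'.{v, max u v} (Module.rank A (K ⊗[A] M))]
  exact h2.trans (by rw [Cardinal.lift_umax.{v, u}])

/-! ### Almost finitely generated modules -/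

section FreeAndBounded

variable {O : Type u} [CommRing O] {M : Type v} [AddCommGroup M] [Module O M]

theorem Submodule.exists_fg_map_eq {N : Type v} [AddCommGroup N] [Module O N] {f : M →ₗ[O] N}
    (hf : Function.Surjective f) {G : Submodule O N} (hG : G.FG) :
    ∃ F : Submodule O M, F.FG ∧ F.map f = G := by
  obtain ⟨t, ht⟩ := hG
  choose g hg using hf
  refine ⟨Submodule.span O (g '' t), Submodule.fg_span (t.finite_toSet.image g), ?_⟩
  rw [Submodule.map_span, ← Set.image_comp, ← ht]
  congr 1
  ext x
  simp [hg]

theorem isPrecomplete_of_finite_free {p : O} [IsPrecomplete (Ideal.span {p}) O]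
    [Module.Finite O M] [Module.Free O M] : IsPrecomplete (Ideal.span {p}) M := by
  rw [isPrecomplete_span_singleton_iff]
  intro f hf
  let e := (Module.Free.chooseBasis O M).equivFun
  have hlim : ∀ i, ∃ L : O, ∀ n, ∃ y : O, p ^ n • y = L - e (f n) i := fun i => by
    refine isPrecomplete_span_singleton_iff (p := p).1 inferInstance _ fun n => ?_
    obtain ⟨y, hy⟩ := hf n
    exact ⟨e y i, by rw [← Pi.smul_apply, ← map_smul, hy, map_sub, Pi.sub_apply]⟩
  choose L y hy using hlim
  refine ⟨e.symm L, fun n => ⟨e.symm fun i => y i n, e.injective ?_⟩⟩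
  rw [map_smul, map_sub, e.apply_symm_apply, e.apply_symm_apply]
  exact funext fun i => hy i n

theorem IsBoundedModule.isHausdorff {p : O} [IsHausdorff (Ideal.span {p}) O]
    (hM : IsBoundedModule O M) : IsHausdorff (Ideal.span {p}) M := by
  obtain ⟨I, f, hf⟩ := hM
  rw [isHausdorff_span_singleton_iff]
  intro x hx
  refine hf ?_
  rw [map_zero]
  ext i
  refine isHausdorff_span_singleton_iff.1 ‹IsHausdorff (Ideal.span {p}) O› _ fun n => ?_
  obtain ⟨y, hy⟩ := hx n
  exact ⟨f y i, by rw [← hy, map_smul, Finsupp.smul_apply]⟩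

end FreeAndBounded

section AlmostFG

variable {O : Type u} [CommRing O] [IsDomain O] [ValuationRing O]
variable {M : Type v} [AddCommGroup M] [Module O M]

theorem isSeparatedModule_iff_isHausdorff (hO : valuationHeight O = 1) {p : O}
    (hp : p ∈ IsLocalRing.maximalIdeal O) (hp0 : p ≠ 0) :
    IsSeparatedModule O M ↔ IsHausdorff (Ideal.span {p}) M := by
  have hmem : ∀ x : M, x ∈ divisibleSubmodule O M ↔
      ∀ ϖ ∈ IsLocalRing.maximalIdeal O, ϖ ≠ 0 → ∃ y : M, ϖ • y = x := by
    intro x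
    simp [divisibleSubmodule, Submodule.mem_iInf]
  rw [isHausdorff_span_singleton_iff, IsSeparatedModule, Submodule.eq_bot_iff]
  refine forall_congr' fun x => imp_congr_left ?_
  rw [hmem]
  constructor
  · intro h n
    -- `p ^ 0 = 1` is not in the maximal ideal
    rcases Nat.eq_zero_or_pos n with rfl | hn
    · exact ⟨x, by simp⟩
    · exact h _ (Ideal.pow_mem_of_mem _ hp n hn) (pow_ne_zero n hp0)
  · intro h ϖ hϖ hϖ0
    obtain ⟨n, c, hc⟩ := dvd_pow_of_valuationHeight_eq_one hO hp hϖ0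
    obtain ⟨y, hy⟩ := h n
    exact ⟨c • y, by rw [smul_smul, ← hc, hy]⟩

/-- If `v` is not divisible by `ϖ`, then the span of `v` contains `ϖ • x` for every `x` in its
saturation, because divisibility in a valuation ring is total. -/
theorem exists_smul_eq_smul_of_not_dvd [Module.IsTorsionFree O M] {ϖ a b : O} {v x : M}
    (hv : ∀ y : M, ϖ • y ≠ v) (ha : a ≠ 0) (hab : a • x = b • v) : ∃ d : O, ϖ • x = d • v := by
  rcases ValuationRing.dvd_total a (ϖ * b) with ⟨d, hd⟩ | ⟨c, hc⟩
  · refine ⟨d, smul_right_injective M ha ?_⟩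
    change a • ϖ • x = a • d • v
    rw [smul_comm, hab, smul_smul, smul_smul, hd]
  · have hb : b ≠ 0 := by
      rintro rfl
      exact ha (by simpa using hc)
    refine absurd (smul_right_injective M hb ?_) (hv (c • x))
    change b • ϖ • c • x = b • v
    rw [← hab, hc, smul_smul, smul_smul]
    congr 1
    ring

/-- A separated torsion-free module of rank one is almost finitely generated; a single generator
suffices for each `ϖ`. -/
theorem isAlmostFinitelyGenerated_of_rank_one (hO : valuationHeight O = 1) {p : O}
    (hp0 : p ≠ 0) [Module.IsTorsionFree O M] [IsHausdorff (Ideal.span {p}) M]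
    (hM : ∀ v x : M, v ≠ 0 → ∃ a b : O, a ≠ 0 ∧ a • x = b • v) :
    IsAlmostFinitelyGenerated O M := by
  rcases subsingleton_or_nontrivial M with h | h
  · exact fun ϖ _ => ⟨⊥, Submodule.fg_bot, fun x => by simp [Subsingleton.elim x 0]⟩
  have hndvd : ∀ ϖ ∈ IsLocalRing.maximalIdeal O, ϖ ≠ 0 → ∃ v : M, ∀ y, ϖ • y ≠ v := by
    intro ϖ hϖ hϖ0
    by_contra! hcon
    have hpow : ∀ (n : ℕ) (x : M), ∃ y, ϖ ^ n • y = x := by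
      intro n
      induction n with
      | zero => exact fun x => ⟨x, by simp⟩
      | succ n ih =>
        intro x
        obtain ⟨y, hy⟩ := ih x
        obtain ⟨z, hz⟩ := hcon y
        exact ⟨z, by rw [pow_succ, mul_smul, hz, hy]⟩
    obtain ⟨x, hx⟩ := exists_ne (0 : M)
    refine hx (isHausdorff_span_singleton_iff.1 ‹IsHausdorff (Ideal.span {p}) M› x fun n => ?_)
    obtain ⟨m, c, hc⟩ := dvd_pow_of_valuationHeight_eq_one hO hϖ (pow_ne_zero n hp0)
    obtain ⟨y, hy⟩ := hpow m x
    exact ⟨c • y, by rw [smul_smul, ← hc, hy]⟩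
  have hne : ∀ {ϖ : O} {v : M}, (∀ y, ϖ • y ≠ v) → v ≠ 0 := fun hv h0 => hv 0 (by simp [h0])
  intro ϖ hϖ
  by_cases hD : IsDiscreteValuationRing O
  · obtain ⟨q, hq⟩ := IsDiscreteValuationRing.exists_irreducible O
    have hqm : q ∈ IsLocalRing.maximalIdeal O := (IsLocalRing.mem_maximalIdeal q).2 hq.not_isUnit
    obtain ⟨v, hv⟩ := hndvd q hqm hq.ne_zero
    refine ⟨Submodule.span O {v}, Submodule.fg_span_singleton v, fun x =>
      Submodule.smul_mem _ _ (Submodule.mem_span_singleton.2 ?_)⟩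
    obtain ⟨a, b, ha, hab⟩ := hM v x (hne hv)
    obtain ⟨d, hd⟩ := exists_smul_eq_smul_of_not_dvd hv ha hab
    -- `d` is not a unit since `v` is not divisible by the uniformizer, so `q` can be cancelled
    have hdm : d ∈ IsLocalRing.maximalIdeal O := by
      rw [IsLocalRing.mem_maximalIdeal]
      rintro ⟨d, rfl⟩
      refine hv ((↑d⁻¹ : O) • x) ?_
      rw [smul_comm, hd, smul_smul, Units.inv_mul, one_smul]
    rw [hq.maximalIdeal_eq, Ideal.mem_span_singleton] at hdm
    obtain ⟨e, rfl⟩ := hdm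
    refine ⟨e, smul_right_injective M hq.ne_zero ?_⟩
    change q • e • v = q • x
    rw [hd, smul_smul]
  · rw [almostIdeal, if_neg hD] at hϖ
    by_cases hϖ0 : ϖ = 0
    · exact ⟨⊥, Submodule.fg_bot, fun x => by simp [hϖ0]⟩
    obtain ⟨v, hv⟩ := hndvd ϖ hϖ hϖ0
    refine ⟨Submodule.span O {v}, Submodule.fg_span_singleton v, fun x =>
      Submodule.mem_span_singleton.2 ?_⟩
    obtain ⟨a, b, ha, hab⟩ := hM v x (hne hv)
    obtain ⟨d, hd⟩ := exists_smul_eq_smul_of_not_dvd hv ha hab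
    exact ⟨d, hd.symm⟩

/-- Almost finite generation is stable under extensions. -/
theorem isAlmostFinitelyGenerated_of_quotient (hO : valuationHeight O = 1) (N : Submodule O M)
    (hN : IsAlmostFinitelyGenerated O N) (hQ : IsAlmostFinitelyGenerated O (M ⧸ N)) :
    IsAlmostFinitelyGenerated O M := by
  intro ϖ hϖ
  obtain ⟨α, hα, β, hβ, rfl⟩ := exists_mul_eq_of_mem_almostIdeal hO hϖ
  obtain ⟨F, hF, hs⟩ := hN α hα
  obtain ⟨G, hG, ht⟩ := hQ β hβ
  obtain ⟨G', hG', rfl⟩ := Submodule.exists_fg_map_eq N.mkQ_surjective hG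
  refine ⟨F.map N.subtype ⊔ G', (hF.map _).sup hG', fun x => ?_⟩
  obtain ⟨y, hy, hyx⟩ : ∃ y ∈ G', N.mkQ y = N.mkQ (β • x) := by
    rw [map_smul]
    exact ht (N.mkQ x)
  have h2 : β • x - y ∈ N := by
    rw [← Submodule.Quotient.mk_eq_zero, ← Submodule.mkQ_apply, map_sub, hyx, sub_self]
  have h3 : (α * β) • x = α • (β • x - y) + α • y := by
    rw [← smul_add, sub_add_cancel, mul_smul]
  rw [h3]
  exact add_mem (Submodule.mem_sup_left ⟨_, hs ⟨_, h2⟩, rfl⟩)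
    (Submodule.mem_sup_right (Submodule.smul_mem _ _ hy))

/-- Finitely generated submodules of a torsion-free module are free over a valuation ring, so an
almost finitely generated `M` satisfies `p M ⊆ N ⊆ M` with `N` finite free. -/
theorem IsAlmostFinitelyGenerated.exists_free {p : O} (hp : p ∈ IsLocalRing.maximalIdeal O)
    [Module.IsTorsionFree O M] (hM : IsAlmostFinitelyGenerated O M) :
    ∃ N : Submodule O M, Module.Finite O N ∧ Module.Free O N ∧ ∀ x : M, p • x ∈ N := by
  obtain ⟨N, hN, hx⟩ := hM p (maximalIdeal_le_almostIdeal hp)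
  have hfin : Module.Finite O N := Module.Finite.iff_fg.2 hN
  have hflat : Module.Flat O N := Module.Flat.flat_iff_torsion_eq_bot_of_isBezout.2
    (Submodule.isTorsionFree_iff_torsion_eq_bot.1 inferInstance)
  exact ⟨N, hfin, Module.free_of_flat_of_isLocalRing, hx⟩

theorem IsAlmostFinitelyGenerated.isBoundedModule {p : O}
    (hp : p ∈ IsLocalRing.maximalIdeal O) (hp0 : p ≠ 0) [Module.IsTorsionFree O M]
    (hM : IsAlmostFinitelyGenerated O M) : IsBoundedModule O M := by
  obtain ⟨N, -, hfree, hx⟩ := hM.exists_free hp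
  refine ⟨Module.Free.ChooseBasisIndex O N,
    (Module.Free.chooseBasis O N).repr.toLinearMap ∘ₗ (LinearMap.lsmul O M p).codRestrict N hx,
    (Module.Free.chooseBasis O N).repr.injective.comp fun x y hxy => ?_⟩
  exact smul_right_injective M hp0 (congrArg Subtype.val hxy)

theorem IsAlmostFinitelyGenerated.isPrecomplete {p : O}
    (hp : p ∈ IsLocalRing.maximalIdeal O) (hp0 : p ≠ 0) [IsPrecomplete (Ideal.span {p}) O]
    [Module.IsTorsionFree O M] (hM : IsAlmostFinitelyGenerated O M) :
    IsPrecomplete (Ideal.span {p}) M := by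
  obtain ⟨N, hfin, hfree, hx⟩ := hM.exists_free hp
  rw [isPrecomplete_span_singleton_iff]
  intro f hf
  obtain ⟨L, hL⟩ := (isPrecomplete_span_singleton_iff (p := p)).1
      (isPrecomplete_of_finite_free (O := O) (M := N)) (fun n => ⟨p • f n, hx (f n)⟩) fun n => by
    obtain ⟨y, hy⟩ := hf n
    refine ⟨⟨p • y, hx y⟩, Subtype.ext ?_⟩
    change p ^ n • p • y = p • f (n + 1) - p • f n
    rw [smul_comm, hy, smul_sub]
  choose y hy using hL
  replace hy : ∀ n, p ^ n • (y n : M) = L - p • f n := fun n => congrArg Subtype.val (hy n)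
  -- the limit in `N` is congruent to `p • f 1` modulo `p`, hence divisible by `p` in `M`
  have hLx : (L : M) = p • (f 1 + (y 1 : M)) := by
    have := hy 1
    rw [pow_one] at this
    rw [smul_add, this]
    abel
  refine ⟨f 1 + (y 1 : M), fun n => ?_⟩
  obtain ⟨w, hw⟩ := hf n
  refine ⟨(y (n + 1) : M) + w, smul_right_injective M hp0 ?_⟩
  change p • p ^ n • ((y (n + 1) : M) + w) = p • (f 1 + (y 1 : M) - f n)
  have h1 := hy (n + 1)
  rw [smul_sub, ← hLx, smul_add, hw, smul_add, smul_smul, ← pow_succ', h1, smul_sub]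
  abel

/-- Over a complete valuation ring of height one, separated torsion-free modules of finite rank
are almost finitely generated. By induction on the rank: the saturation of a nonzero vector is
almost finitely generated, hence complete, hence its quotient is again separated. -/
theorem isAlmostFinitelyGenerated_of_isHausdorff (hO : valuationHeight O = 1) {p : O}
    (hp : p ∈ IsLocalRing.maximalIdeal O) (hp0 : p ≠ 0) [IsPrecomplete (Ideal.span {p}) O]
    [Module.IsTorsionFree O M] [IsHausdorff (Ideal.span {p}) M]
    (hM : Module.rank O M < Cardinal.aleph0) : IsAlmostFinitelyGenerated O M := by
  obtain ⟨n, hn⟩ := Cardinal.lt_aleph0.1 hM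
  replace hn := hn.le
  clear hM
  induction n generalizing M with
  | zero =>
    have : Subsingleton M := rank_zero_iff.1 (le_antisymm (by simpa using hn) zero_le)
    exact fun ϖ _ => ⟨⊥, Submodule.fg_bot, fun x => by simp [Subsingleton.elim x 0]⟩
  | succ n ih =>
    rcases subsingleton_or_nontrivial M with h | h
    · exact fun ϖ _ => ⟨⊥, Submodule.fg_bot, fun x => by simp [Subsingleton.elim x 0]⟩
    obtain ⟨v, hv⟩ := exists_ne (0 : M)
    let N := (Submodule.span O {v}).saturation
    have hvN : v ∈ N := Submodule.le_saturation _ (Submodule.mem_span_singleton_self v)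
    have hNH : IsHausdorff (Ideal.span {p}) N := by
      rw [isHausdorff_span_singleton_iff]
      refine fun x hx => Subtype.ext
        (isHausdorff_span_singleton_iff.1 ‹IsHausdorff (Ideal.span {p}) M› x fun n => ?_)
      obtain ⟨y, hy⟩ := hx n
      exact ⟨y, congrArg Subtype.val hy⟩
    have hN : IsAlmostFinitelyGenerated O N := by
      refine isAlmostFinitelyGenerated_of_rank_one hO hp0 ?_
      rintro ⟨w, a, ha, hw⟩ ⟨x, b, hb, hx⟩ hw0
      obtain ⟨c, hc⟩ := Submodule.mem_span_singleton.1 hw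
      obtain ⟨d, hd⟩ := Submodule.mem_span_singleton.1 hx
      have hc0 : c ≠ 0 := by
        rintro rfl
        rw [zero_smul] at hc
        exact hw0 (Subtype.ext ((smul_eq_zero.1 hc.symm).resolve_left ha))
      refine ⟨c * b, d * a, mul_ne_zero hc0 hb, Subtype.ext ?_⟩
      change (c * b) • x = (d * a) • w
      rw [mul_smul, mul_smul, ← hd, ← hc, smul_comm]
    have hNP : IsPrecomplete (Ideal.span {p}) N := hN.isPrecomplete hp hp0
    have hQH : IsHausdorff (Ideal.span {p}) (M ⧸ N) := isHausdorff_quotient N fun n x hx =>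
      Submodule.mem_saturation_of_smul_mem (pow_ne_zero n hp0) hx
    have hQT : Module.IsTorsionFree O (M ⧸ N) := Submodule.isTorsionFree_quotient_saturation _
    have hrank : Module.rank O (M ⧸ N) ≤ n := by
      have h1 : 1 ≤ Module.rank O N := Cardinal.one_le_iff_pos.2
        (rank_pos_iff_exists_ne_zero.2 ⟨⟨v, hvN⟩, fun h => hv (congrArg Subtype.val h)⟩)
      refine Cardinal.add_one_le_add_one_iff.1 ?_
      calc Module.rank O (M ⧸ N) + 1 ≤ Module.rank O (M ⧸ N) + Module.rank O N := by gcongr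
        _ = Module.rank O M := rank_quotient_add_rank_of_isDomain N
        _ ≤ n + 1 := by exact_mod_cast hn
    exact isAlmostFinitelyGenerated_of_quotient hO N hN (ih hrank)

/-- Over a complete valuation ring of height one, boundedness, separatedness, completeness and
almost finite generation agree for torsion-free modules of finite rank. -/
theorem tfae_of_isAdicComplete (hO : valuationHeight O = 1) {p : O}
    (hp : p ∈ IsLocalRing.maximalIdeal O) (hp0 : p ≠ 0) [IsAdicComplete (Ideal.span {p}) O]
    [Module.IsTorsionFree O M] (hM : Module.rank O M < Cardinal.aleph0) :
    List.TFAE [IsBoundedModule O M, IsSeparatedModule O M,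
      IsAdicComplete (Ideal.span {p}) M, IsAlmostFinitelyGenerated O M] := by
  rw [isSeparatedModule_iff_isHausdorff hO hp hp0]
  tfae_have 1 → 2 := fun h => h.isHausdorff
  tfae_have 2 → 4 := fun h => isAlmostFinitelyGenerated_of_isHausdorff hO hp hp0 hM
  tfae_have 4 → 1 := fun h => h.isBoundedModule hp hp0
  tfae_have 4 → 3 := fun h =>
    { toIsHausdorff := (h.isBoundedModule hp hp0).isHausdorff
      toIsPrecomplete := h.isPrecomplete hp hp0 }
  tfae_have 3 → 2 := fun h => h.toIsHausdorff
  tfae_finish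

end AlmostFG

/-! ### Valuation rings obtained by completion -/

theorem pow_smul_eq_zero_of_regular {O : Type u} [CommRing O] {p : O} {N : Type*}
    [AddCommGroup N] [Module O N]
    (hreg : ∀ a : N, p • a = 0 → a = 0) (n : ℕ) (a : N) (h : p ^ n • a = 0) : a = 0 := by
  induction n with
  | zero => simpa using h
  | succ n ih =>
    refine ih (hreg _ ?_)
    rwa [smul_smul, ← pow_succ']

theorem algebraMap_mem_maximalIdeal {O : Type u} [CommRing O] {A : Type v} [CommRing A]
    [IsLocalRing A] [Algebra O A] {p : O} (hp1 : ∀ a : A, p • a ≠ 1) :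
    algebraMap O A p ∈ IsLocalRing.maximalIdeal A := by
  rw [IsLocalRing.mem_maximalIdeal]
  intro h
  obtain ⟨b, hb⟩ := h.exists_right_inv
  exact hp1 b (by rw [Algebra.smul_def, hb])

section CompleteRing

variable {O : Type u} [CommRing O] [IsDomain O] [ValuationRing O]
variable {A : Type v} [CommRing A] [Algebra O A] {p : O}

/-- In a `p`-adically complete algebra in which `O` is dense, every nonzero element is a scalar
from `O` up to a unit, and that scalar divides a power of `p`. -/
theorem exists_eq_algebraMap_mul_unit [IsAdicComplete (Ideal.span {p}) A]
    (hdense : ∀ (n : ℕ) (a : A), ∃ x : O, ∃ y : A, a = algebraMap O A x + p ^ n • y)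
    {a : A} (ha : a ≠ 0) :
    ∃ (x : O) (n : ℕ) (w : Aˣ), x ≠ 0 ∧ x ∣ p ^ n ∧ a = algebraMap O A x * w := by
  obtain ⟨n, hn⟩ : ∃ n : ℕ, ∀ y : A, p ^ n • y ≠ a := by
    by_contra! h
    exact ha (isHausdorff_span_singleton_iff (p := p) (M := A).1 inferInstance a h)
  obtain ⟨x, y, hxy⟩ := hdense (n + 1) a
  have hndvd : ¬ p ^ n ∣ x := by
    rintro ⟨c, rfl⟩
    refine hn (algebraMap O A c + p • y) ?_
    rw [hxy, smul_add, smul_smul, ← pow_succ, map_mul, Algebra.smul_def (p ^ n)]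
  obtain ⟨c, hc⟩ := (ValuationRing.dvd_total (p ^ n) x).resolve_left hndvd
  -- `a = x * (1 + p * c * y)`, where the second factor is a unit by completeness
  have hcomp : IsAdicComplete ((Ideal.span {p}).map (algebraMap O A)) A :=
    (IsAdicComplete.map_algebraMap_iff _ A).2 inferInstance
  have hjac : algebraMap O A p ∈ Ideal.jacobson (⊥ : Ideal A) :=
    IsAdicComplete.le_jacobson_bot _
      (Ideal.mem_map_of_mem _ (Ideal.mem_span_singleton_self p))
  obtain ⟨w, hw⟩ := Ideal.mem_jacobson_bot.1 hjac (algebraMap O A c * y)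
  refine ⟨x, n, w, fun h0 => hndvd (h0 ▸ dvd_zero _), ⟨c, hc⟩, ?_⟩
  rw [hw, hxy, Algebra.smul_def, pow_succ, hc]
  simp only [map_mul]
  ring

theorem isTorsionFree_of_dense [IsDomain A] [IsAdicComplete (Ideal.span {p}) A]
    (hdense : ∀ (n : ℕ) (a : A), ∃ x : O, ∃ y : A, a = algebraMap O A x + p ^ n • y)
    {N : Type*} [AddCommGroup N] [Module O N] [Module A N] [IsScalarTower O A N]
    (hreg : ∀ a : N, p • a = 0 → a = 0) : Module.IsTorsionFree A N := by
  refine Module.IsTorsionFree.of_smul_eq_zero fun a z haz => or_iff_not_imp_left.2 fun ha => ?_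
  obtain ⟨x, n, w, -, ⟨c, hc⟩, rfl⟩ := exists_eq_algebraMap_mul_unit hdense ha
  refine pow_smul_eq_zero_of_regular (p := p) hreg n z ?_
  rw [mul_comm, mul_smul, ← Units.smul_def, smul_eq_zero_iff_eq, algebraMap_smul] at haz
  rw [hc, mul_comm, mul_smul, haz, smul_zero]

theorem isDomain_of_dense [IsAdicComplete (Ideal.span {p}) A]
    (hdense : ∀ (n : ℕ) (a : A), ∃ x : O, ∃ y : A, a = algebraMap O A x + p ^ n • y)
    (hreg : ∀ a : A, p • a = 0 → a = 0) (hp1 : ∀ a : A, p • a ≠ 1) : IsDomain A := by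
  have hnt : Nontrivial A := ⟨p • (1 : A), 1, hp1 1⟩
  have hnzd : NoZeroDivisors A := by
    refine ⟨fun {a b} hab => or_iff_not_imp_left.2 fun ha => ?_⟩
    obtain ⟨x, n, w, -, ⟨c, hc⟩, rfl⟩ := exists_eq_algebraMap_mul_unit hdense ha
    refine pow_smul_eq_zero_of_regular (p := p) hreg n b ?_
    rw [mul_comm (algebraMap O A x), mul_assoc, Units.mul_right_eq_zero, ← Algebra.smul_def] at hab
    rw [hc, mul_comm, mul_smul, hab, smul_zero]
  exact NoZeroDivisors.to_isDomain A

theorem valuationRing_of_dense [IsDomain A] [IsAdicComplete (Ideal.span {p}) A]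
    (hdense : ∀ (n : ℕ) (a : A), ∃ x : O, ∃ y : A, a = algebraMap O A x + p ^ n • y) :
    ValuationRing A := by
  refine ValuationRing.iff_dvd_total.2 ⟨fun a b => ?_⟩
  by_cases ha : a = 0
  · exact Or.inr (ha ▸ dvd_zero b)
  by_cases hb : b = 0
  · exact Or.inl (hb ▸ dvd_zero a)
  obtain ⟨x, -, w, -, -, rfl⟩ := exists_eq_algebraMap_mul_unit hdense ha
  obtain ⟨y, -, z, -, -, rfl⟩ := exists_eq_algebraMap_mul_unit hdense hb
  simp only [Units.mul_right_dvd, Units.dvd_mul_right]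
  exact (ValuationRing.dvd_total x y).imp (map_dvd _) (map_dvd _)

theorem valuationHeight_eq_one_of_dense (hO : valuationHeight O = 1) [IsDomain A]
    [ValuationRing A] [IsAdicComplete (Ideal.span {p}) A]
    (hdense : ∀ (n : ℕ) (a : A), ∃ x : O, ∃ y : A, a = algebraMap O A x + p ^ n • y)
    (hp0 : algebraMap O A p ≠ 0) (hp1 : ∀ a : A, p • a ≠ 1) : valuationHeight A = 1 := by
  refine Set.encard_eq_one.2 ⟨IsLocalRing.maximalIdeal A, Set.ext fun P => ⟨?_, ?_⟩⟩
  · rintro ⟨hP, hP0⟩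
    refine le_antisymm (IsLocalRing.le_maximalIdeal hP.ne_top) fun q hq => ?_
    obtain ⟨a, haP, ha0⟩ := Submodule.exists_mem_ne_zero_of_ne_bot hP0
    by_cases hq0 : q = 0
    · exact hq0 ▸ zero_mem P
    obtain ⟨x, -, w, hx0, -, rfl⟩ := exists_eq_algebraMap_mul_unit hdense ha0
    obtain ⟨y, -, z, -, -, rfl⟩ := exists_eq_algebraMap_mul_unit hdense hq0
    have hy : y ∈ IsLocalRing.maximalIdeal O := by
      rw [IsLocalRing.mem_maximalIdeal]
      intro hyu
      exact (IsLocalRing.mem_maximalIdeal _).1 hq ((hyu.map (algebraMap O A)).mul z.isUnit)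
    obtain ⟨n, hn⟩ := dvd_pow_of_valuationHeight_eq_one hO hy hx0
    have hxP : algebraMap O A x ∈ P := (Ideal.mul_unit_mem_iff_mem P w.isUnit).1 haP
    have hyP : algebraMap O A y ^ n ∈ P := by
      rw [← map_pow]
      exact P.mem_of_dvd (map_dvd _ hn) hxP
    exact P.mul_mem_right _ (hP.mem_of_pow_mem n hyP)
  · rintro rfl
    refine ⟨inferInstance, fun h => hp0 ?_⟩
    have := algebraMap_mem_maximalIdeal (A := A) hp1
    rwa [h, Ideal.mem_bot] at this

end CompleteRing

/-! ### Completions for a principal ideal -/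

section Completion

variable {R : Type u} [CommRing R] {M : Type v} [AddCommGroup M] [Module R M] {p : R}

theorem AdicCompletion.val_eq_zero_iff_of_span_singleton {n : ℕ}
    {x : AdicCompletion (Ideal.span {p}) M} :
    x.val n = 0 ↔ ∃ y : AdicCompletion (Ideal.span {p}) M, p ^ n • y = x := by
  rw [← mem_span_singleton_pow_smul_top,
    AdicCompletion.pow_smul_top_eq_ker_eval (Submodule.fg_span_singleton p), LinearMap.mem_ker,
    AdicCompletion.eval_apply]

theorem AdicCompletion.exists_eq_of_add_pow_smul (n : ℕ)
    (x : AdicCompletion (Ideal.span {p}) M) :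
    ∃ (m : M) (y : AdicCompletion (Ideal.span {p}) M),
      x = AdicCompletion.of (Ideal.span {p}) M m + p ^ n • y := by
  obtain ⟨m, hm⟩ := Submodule.mkQ_surjective _ (x.val n)
  obtain ⟨y, hy⟩ := (val_eq_zero_iff_of_span_singleton (n := n)
    (x := x - AdicCompletion.of (Ideal.span {p}) M m)).1 (by
      rw [AdicCompletion.val_sub_apply, AdicCompletion.of_apply, hm, sub_self])
  exact ⟨m, y, by rw [hy]; abel⟩

theorem AdicCompletion.eq_zero_of_smul_eq_zero (hreg : ∀ m : M, p • m = 0 → m = 0)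
    (x : AdicCompletion (Ideal.span {p}) M) (hx : p • x = 0) : x = 0 := by
  ext n
  rw [AdicCompletion.val_zero_apply, AdicCompletion.val_eq_zero_iff_of_span_singleton]
  obtain ⟨m, y, rfl⟩ := AdicCompletion.exists_eq_of_add_pow_smul n x
  -- `p • m` vanishes modulo `p ^ (n + 1)`, so `m` vanishes modulo `p ^ n`
  have h1 : (AdicCompletion.of (Ideal.span {p}) M (p • m)).val (n + 1) = 0 := by
    rw [AdicCompletion.val_eq_zero_iff_of_span_singleton]
    refine ⟨-y, ?_⟩
    rw [smul_add, smul_smul, ← pow_succ'] at hx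
    rw [map_smul, smul_neg, eq_comm]
    exact eq_neg_of_add_eq_zero_left hx
  rw [AdicCompletion.of_apply, Submodule.mkQ_apply, Submodule.Quotient.mk_eq_zero,
    mem_span_singleton_pow_smul_top] at h1
  obtain ⟨z, hz⟩ := h1
  have h2 : m = p ^ n • z := by
    rw [← sub_eq_zero]
    refine hreg _ ?_
    rw [smul_sub, ← hz, smul_smul, ← pow_succ', sub_self]
  exact ⟨AdicCompletion.of (Ideal.span {p}) M z + y, by rw [h2, smul_add, map_smul]⟩

theorem AdicCompletion.algebraMap_eq_of (x : R) :
    algebraMap R (AdicCompletion (Ideal.span {p}) R) x =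
      AdicCompletion.of (Ideal.span {p}) R x := rfl

theorem AdicCompletion.smul_ne_one (hp : ¬ IsUnit p)
    (x : AdicCompletion (Ideal.span {p}) R) : p • x ≠ 1 := by
  intro h
  have h1 : (AdicCompletion.of (Ideal.span {p}) R 1).val 1 = 0 := by
    rw [AdicCompletion.val_eq_zero_iff_of_span_singleton]
    exact ⟨x, by rw [pow_one, h, ← AdicCompletion.algebraMap_eq_of, map_one]⟩
  rw [AdicCompletion.of_apply, Submodule.mkQ_apply, Submodule.Quotient.mk_eq_zero,
    mem_span_singleton_pow_smul_top] at h1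
  obtain ⟨y, hy⟩ := h1
  exact hp (IsUnit.of_mul_eq_one y (by simpa using hy))

end Completion

/-! ### Modules of finite rank over the completion -/

/-- Over a complete algebra `A`, a separated torsion-free module `P` in which the image of an
`O`-module `M` of finite rank is dense is spanned by this image: the span has finite rank, hence is
complete. -/
theorem span_range_eq_top_of_dense {O : Type u} [CommRing O] [IsDomain O] {M : Type v}
    [AddCommGroup M] [Module O M] {p : O} {A : Type u} [CommRing A] [IsDomain A] [ValuationRing A]
    [Algebra O A] (hinj : Function.Injective (algebraMap O A)) (hA : valuationHeight A = 1)
    (hpA : algebraMap O A p ∈ IsLocalRing.maximalIdeal A) (hp0 : algebraMap O A p ≠ 0)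
    [IsAdicComplete (Ideal.span {algebraMap O A p}) A] {P : Type v} [AddCommGroup P] [Module O P]
    [Module A P] [IsScalarTower O A P] [Module.IsTorsionFree A P]
    [IsHausdorff (Ideal.span {algebraMap O A p}) P] (f : M →ₗ[O] P)
    (hM : Module.rank O M < Cardinal.aleph0) (hf : ∀ x : P, ∃ m y, x = f m + p • y) :
    Submodule.span A (Set.range f) = ⊤ := by
  let N := Submodule.span A (Set.range f)
  have hmem : ∀ m, f m ∈ N := fun m => Submodule.subset_span ⟨m, rfl⟩
  let g : M →ₗ[O] N := f.codRestrict (N.restrictScalars O) hmem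
  have hg : Submodule.span A (Set.range g) = ⊤ := by
    refine Submodule.map_injective_of_injective N.injective_subtype ?_
    rw [Submodule.map_span, Submodule.map_top, Submodule.range_subtype, ← Set.range_comp]
    rfl
  have hrank : Module.rank A N < Cardinal.aleph0 :=
    (rank_le_rank_of_span_eq_top hinj g hg hM).trans_lt hM
  have hNH : IsHausdorff (Ideal.span {algebraMap O A p}) N := by
    rw [isHausdorff_span_singleton_iff]
    refine fun x hx => Subtype.ext (isHausdorff_span_singleton_iff.1
      ‹IsHausdorff (Ideal.span {algebraMap O A p}) P› x fun n => ?_)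
    obtain ⟨y, hy⟩ := hx n
    exact ⟨y, congrArg Subtype.val hy⟩
  have hNP : IsPrecomplete (Ideal.span {algebraMap O A p}) N :=
    (isAlmostFinitelyGenerated_of_isHausdorff hA hpA hp0 hrank).isPrecomplete hpA hp0
  refine eq_top_of_isPrecomplete_of_dense (p := algebraMap O A p) N fun x => ?_
  obtain ⟨m, y, rfl⟩ := hf x
  exact ⟨f m, hmem m, y, by rw [algebraMap_smul]⟩

theorem mainTheorem7 {O K : Type u} [CommRing O] [IsDomain O] [ValuationRing O]
    [Field K] [Algebra O K] [IsFractionRing O K]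
    (hheight : valuationHeight O = 1)
    {M : Type v} [AddCommGroup M] [Module O M] [Module.IsTorsionFree O M]
    (hrank : valuationRank O K M < Cardinal.aleph0)
    (π : O) (hπ : π ∈ IsLocalRing.maximalIdeal O) (hπ0 : π ≠ 0) :
    (∃ (_ : IsDomain (AdicCompletion (Ideal.span {π}) O))
        (_ : ValuationRing (AdicCompletion (Ideal.span {π}) O)),
      valuationHeight (AdicCompletion (Ideal.span {π}) O) = 1 ∧
      IsAlmostFinitelyGenerated (AdicCompletion (Ideal.span {π}) O)
        (AdicCompletion (Ideal.span {π}) M) ∧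
      Module.IsTorsionFree (AdicCompletion (Ideal.span {π}) O)
        (AdicCompletion (Ideal.span {π}) M) ∧
      valuationRank (AdicCompletion (Ideal.span {π}) O)
          (FractionRing (AdicCompletion (Ideal.span {π}) O))
          (AdicCompletion (Ideal.span {π}) M) ≤ valuationRank O K M ∧
      Function.Surjective (AdicCompletion.ofTensorProduct (Ideal.span {π}) M)) ∧
    (IsAdicComplete (Ideal.span {π}) O →
      List.TFAE [IsBoundedModule O M, IsSeparatedModule O M,
        IsAdicComplete (Ideal.span {π}) M, IsAlmostFinitelyGenerated O M]) := by
  rw [valuationRank_eq_lift_rank K, Cardinal.lift_lt_aleph0] at hrank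
  refine ⟨?_, fun _ => tfae_of_isAdicComplete hheight hπ hπ0 hrank⟩
  have hfg : (Ideal.span {π}).FG := Submodule.fg_span_singleton π
  have hAO : IsAdicComplete (Ideal.span {π}) (AdicCompletion (Ideal.span {π}) O) :=
    AdicCompletion.isAdicComplete hfg
  have hdense : ∀ (n : ℕ) (a : AdicCompletion (Ideal.span {π}) O),
      ∃ x : O, ∃ y : AdicCompletion (Ideal.span {π}) O,
        a = algebraMap O (AdicCompletion (Ideal.span {π}) O) x + π ^ n • y :=
    AdicCompletion.exists_eq_of_add_pow_smul
  have hreg : ∀ x : AdicCompletion (Ideal.span {π}) O, π • x = 0 → x = 0 :=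
    AdicCompletion.eq_zero_of_smul_eq_zero fun m hm => (smul_eq_zero.1 hm).resolve_left hπ0
  have hp1 : ∀ x : AdicCompletion (Ideal.span {π}) O, π • x ≠ 1 :=
    AdicCompletion.smul_ne_one ((IsLocalRing.mem_maximalIdeal π).1 hπ)
  have hD : IsDomain (AdicCompletion (Ideal.span {π}) O) := isDomain_of_dense hdense hreg hp1
  have hV : ValuationRing (AdicCompletion (Ideal.span {π}) O) := valuationRing_of_dense hdense
  have hT : Module.IsTorsionFree (AdicCompletion (Ideal.span {π}) O)
      (AdicCompletion (Ideal.span {π}) M) :=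
    isTorsionFree_of_dense hdense (AdicCompletion.eq_zero_of_smul_eq_zero fun m hm =>
      (smul_eq_zero.1 hm).resolve_left hπ0)
  have hp0 : algebraMap O (AdicCompletion (Ideal.span {π}) O) π ≠ 0 := fun h =>
    one_ne_zero (hreg 1 (by rw [Algebra.smul_def, h, zero_mul]))
  have hinj : Function.Injective (algebraMap O (AdicCompletion (Ideal.span {π}) O)) := by
    rw [injective_iff_map_eq_zero]
    intro x hx
    by_contra hx0
    obtain ⟨n, hn⟩ := dvd_pow_of_valuationHeight_eq_one hheight hπ hx0
    have h := map_dvd (algebraMap O (AdicCompletion (Ideal.span {π}) O)) hn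
    rw [hx, zero_dvd_iff, map_pow] at h
    exact pow_ne_zero n hp0 h
  have hH : valuationHeight (AdicCompletion (Ideal.span {π}) O) = 1 :=
    valuationHeight_eq_one_of_dense hheight hdense hp0 hp1
  have hpm := algebraMap_mem_maximalIdeal (A := AdicCompletion (Ideal.span {π}) O) hp1
  have hmap : (Ideal.span {π}).map (algebraMap O (AdicCompletion (Ideal.span {π}) O)) =
      Ideal.span {algebraMap O (AdicCompletion (Ideal.span {π}) O) π} := by
    rw [Ideal.map_span, Set.image_singleton]
  have hAA : IsAdicComplete (Ideal.span {algebraMap O (AdicCompletion (Ideal.span {π}) O) π})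
      (AdicCompletion (Ideal.span {π}) O) :=
    hmap ▸ (IsAdicComplete.map_algebraMap_iff _ _).2 hAO
  have hMH : IsHausdorff (Ideal.span {algebraMap O (AdicCompletion (Ideal.span {π}) O) π})
      (AdicCompletion (Ideal.span {π}) M) :=
    hmap ▸ IsHausdorff.map_algebraMap_iff.2 inferInstance
  have hspan := span_range_eq_top_of_dense hinj hH hpm hp0
    (AdicCompletion.of (Ideal.span {π}) M) hrank fun x => by
      simpa using AdicCompletion.exists_eq_of_add_pow_smul 1 x
  have hle := rank_le_rank_of_span_eq_top hinj _ hspan hrank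
  refine ⟨hD, hV, hH, isAlmostFinitelyGenerated_of_isHausdorff hH hpm hp0 (hle.trans_lt hrank),
    hT, ?_, ?_⟩
  · rw [valuationRank_eq_lift_rank, valuationRank_eq_lift_rank]
    exact Cardinal.lift_le.2 hle
  · rw [← LinearMap.range_eq_top, eq_top_iff, ← hspan, Submodule.span_le]
    rintro _ ⟨m, rfl⟩
    exact ⟨1 ⊗ₜ m, by rw [AdicCompletion.ofTensorProduct_tmul, one_smul]⟩
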